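/- Let $K$ be a field, $k\ge 2$, $n\ge k$, and $R=K[x_1,\dots,x_k]$. Let $\mathcal A$ be a central hyperplane arrangement of rank $k$ and size $n$, given by nonzero linear forms $\ell_1,\dots,\ell_n\in R$, no two of them proportional, with $\langle \ell_1,\dots,\ell_n\rangle=\langle x_1,\dots,x_k\rangle$. Put $f_i=\prod_{j\ne i}\ell_j$ and $I_{n-1}(\mathcal A)=\langle f_1,\dots,f_n\rangle\subset R$. Let $S=K[y_1,\dots,y_n]\subset T=R[y_1,\dots,y_n]$, with $T$ bigraded by $\deg x_i=(1,0)$, $\deg y_j=(0,1)$. Let $\mathcal I$ be the kernel of the $R$-algebra map $T\to R[I_{n-1}(\mathcal A)t]$, $y_i\mapsto f_it$, onto the Rees algebra; let $\mathcal I_1\subset T$ be the ideal generated by the elements of $\mathcal I$ that are homogeneous of degree $1$ in $y_1,\dots,y_n$ (so that $T/\mathcal I_1$ presents the symmetric algebra of $I_{n-1}(\mathcal A)$); and let $\mathcal I_{(0,-)}=\mathcal I\cap S$. Let $\partial(\mathcal A)\subset S$ be the Orlik–Terao ideal, generated by the polynomials $\sum_{i\in D} c_i\prod_{j\in D\setminus\{i\}}y_j$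 for all $D\subseteq\{1,\dots,n\}$ and $c_i\in K$ with $\sum_{i\in D}c_i\ell_i=0$. Then $I_{n-1}(\mathcal A)$ is of fiber type, that is, $$\mathcal I=\mathcal I_1+\langle \mathcal I_{(0,-)}\rangle\quad\text{in } T.$$ Moreover $$\mathcal I_1=\langle \ell_iy_i-\ell_{i+1}y_{i+1}\mid 1\le i\le n-1\rangle,\qquad \mathcal I_{(0,-)}=\partial(\mathcal A),$$ and hence $\mathcal I=\langle \ell_iy_i-\ell_{i+1}y_{i+1}\mid 1\le i\le n-1\rangle+\partial(\mathcal A)T$. -/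

import Mathlib

namespace Blowup

open MvPolynomial

/-- The surjection `R[y₁, …, yₙ] → R[It]`, `yᵢ ↦ gᵢ t`, onto the Rees algebra of the ideal
`I = ⟨g₁, …, gₙ⟩`. -/
noncomputable def reesPresentation {R : Type*} [CommRing R] {n : ℕ} (g : Fin n → R) :
    MvPolynomial (Fin n) R →ₐ[R] reesAlgebra (Ideal.span (Set.range g)) :=
  aeval fun i =>
    ⟨Polynomial.monomial 1 (g i),
      reesAlgebra.monomial_mem.2 (by
        rw [pow_one]
        exact Ideal.subset_span (Set.mem_range_self i))⟩

/-- The presentation ideal `𝓘 ⊆ T = R[y₁, …, yₙ]` of the Rees algebra of `⟨g₁, …, gₙ⟩`. -/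
noncomputable def reesIdeal {R : Type*} [CommRing R] {n : ℕ} (g : Fin n → R) :
    Ideal (MvPolynomial (Fin n) R) :=
  RingHom.ker (reesPresentation g)

/-- The ideal `𝓘₁ = ⟨𝓘_(-,1)⟩` of `T`, generated by the elements of `𝓘` that are homogeneous of
degree one in the variables `y`; these are the `s₁ y₁ + ⋯ + sₙ yₙ` with `s` a syzygy of `g`, so
`T / 𝓘₁` is the symmetric algebra of the ideal `⟨g₁, …, gₙ⟩`. -/
noncomputable def symIdeal {R : Type*} [CommRing R] {n : ℕ} (g : Fin n → R) :
    Ideal (MvPolynomial (Fin n) R) :=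
  Ideal.span {F | F ∈ reesIdeal g ∧ F.IsHomogeneous 1}

/-- The inclusion of `S = K[y₁, …, yₙ]` in `T = K[x₁, …, xₖ][y₁, …, yₙ]`. -/
noncomputable def inclST (K : Type*) [Field K] (k n : ℕ) :
    MvPolynomial (Fin n) K →+* MvPolynomial (Fin n) (MvPolynomial (Fin k) K) :=
  MvPolynomial.map C

/-- The ideal `⟨𝓘_(0,-)⟩_S` of `S = K[y₁, …, yₙ]`: the elements of `𝓘` of degree zero in the
variables `x`, that is, `𝓘 ∩ S`. It defines the special fiber. -/
noncomputable def fiberIdeal {K : Type*} [Field K] {k n : ℕ}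
    (g : Fin n → MvPolynomial (Fin k) K) : Ideal (MvPolynomial (Fin n) K) :=
  (reesIdeal g).comap (inclST K k n)

/-- The ideal with the given generators is of fiber type: `𝓘 = 𝓘₁ + ⟨𝓘_(0,-)⟩` in `T`. -/
def IsFiberType {K : Type*} [Field K] {k n : ℕ} (g : Fin n → MvPolynomial (Fin k) K) : Prop :=
  reesIdeal g = symIdeal g ⊔ (fiberIdeal g).map (inclST K k n)

/-- A central arrangement of size `n` and rank `k`: `n` distinct hyperplanes through the origin
of `K^k`, given by linear forms `ℓ₁, …, ℓₙ` in `R = K[x₁, …, xₖ]` such that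
`⟨ℓ₁, …, ℓₙ⟩ = ⟨x₁, …, xₖ⟩`. -/
structure CentralArrangement (K : Type*) [Field K] (k n : ℕ) where
  /-- the defining linear forms -/
  form : Fin n → MvPolynomial (Fin k) K
  isHomogeneous : ∀ i, (form i).IsHomogeneous 1
  ne_zero : ∀ i, form i ≠ 0
  /-- no two forms are proportional -/
  not_proportional : ∀ i j, i ≠ j → ∀ c : K, form i ≠ c • form j
  span_form : Ideal.span (Set.range form) = Ideal.span (Set.range X)

namespace CentralArrangement

variable {K : Type*} [Field K] {k n : ℕ}

/-- The `(n-1)`-fold products `fᵢ = ∏_{j ≠ i} ℓⱼ`, the chosen generators of `I_{n-1}(𝒜)`. -/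
noncomputable def products (A : CentralArrangement K k n) (i : Fin n) :
    MvPolynomial (Fin k) K :=
  ∏ j ∈ Finset.univ.erase i, A.form j

/-- The polynomial `∂D = ∑_{i ∈ s} cᵢ ∏_{j ∈ s, j ≠ i} yⱼ` attached to `D : ∑_{i ∈ s} cᵢ ℓᵢ = 0`. -/
noncomputable def boundary (s : Finset (Fin n)) (c : Fin n → K) : MvPolynomial (Fin n) K :=
  ∑ i ∈ s, C (c i) * ∏ j ∈ s.erase i, X j

/-- The Orlik–Terao ideal `∂(𝒜)` of `S = K[y₁, …, yₙ]`, generated by the `∂D` for all linear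
dependencies `D` among the forms of `𝒜`. -/
noncomputable def orlikTeraoIdeal (A : CentralArrangement K k n) :
    Ideal (MvPolynomial (Fin n) K) :=
  Ideal.span {P | ∃ (s : Finset (Fin n)) (c : Fin n → K),
    ∑ i ∈ s, c i • A.form i = 0 ∧ P = boundary s c}

/-- The ideal `⟨ℓᵢ yᵢ - ℓᵢ₊₁ yᵢ₊₁ | 1 ≤ i ≤ n - 1⟩` of `T`. -/
noncomputable def consecutiveIdeal (A : CentralArrangement K k n) :
    Ideal (MvPolynomial (Fin n) (MvPolynomial (Fin k) K)) :=
  Ideal.span {F | ∃ i j : Fin n, j.val = i.val + 1 ∧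
    F = C (A.form i) * X i - C (A.form j) * X j}

end CentralArrangement

end Blowup

/-!
Write `fᵢ = ∏_{j ≠ i} ℓⱼ`. The heart of the proof is `ker_productHom_eq`: for arbitrary nonzero
linear forms `ℓᵢ`, proportional or not, the kernel of `yᵢ ↦ fᵢ t` is the ideal `J` generated by the
`ℓᵢ yᵢ - ℓⱼ yⱼ` and the Orlik–Terao relations `∂D`. Allowing proportional forms makes the class of
families stable under restriction to a hyperplane, so one can use induction on the number of forms.

Let `ℓ₀` be one of the forms. If it is proportional to another `ℓ_b`, then `J` contains some
`y₀ - c y_b`, and `y₀` can be eliminated. Otherwise let `F = ∑_{j ≤ m} Fⱼ y₀ʲ` be in the kernel,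
with `Fⱼ` free of `y₀`. Up to a common factor, `yᵢ` is sent to `t / ℓᵢ`; comparing polar parts along
`ℓ₀ = 0` shows for `m ≥ 1` that the restriction of `F_m` to this hyperplane lies in the kernel for
the restricted forms (`productHom_map_leadingCoeff`), and so, by induction, in the ideal of relations of
the restricted forms. Those relations lift: a dependency `∑ cᵢ ℓᵢ ≡ 0` modulo `ℓ₀` is a dependency
`∑ cᵢ ℓᵢ = d ℓ₀`, whose boundary expresses `y₀ ∂D` without `y₀`, and `y₀ ℓ₀ ≡ y₁ ℓ₁`. Hence `y₀ F_m`
is congruent modulo `J` to a polynomial free of `y₀` (`mem_eliminationIdeal_of_specialization`), and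
the degree of `F` in `y₀` drops. Once it is zero, the induction hypothesis for the remaining forms
applies.

The two remaining equalities are direct. A syzygy `∑ rᵢ fᵢ = 0` has `ℓᵢ ∣ rᵢ`, because the forms are
pairwise non-proportional, and the quotients sum to zero; this gives `𝓘₁`. Setting `x = 0` maps `J`
onto the Orlik–Terao ideal and fixes `S`; this gives `𝓘 ∩ S`.
-/

namespace Blowup

open MvPolynomial

variable {K : Type*} [Field K] {k n : ℕ}

/-! ### Restriction to a hyperplane -/

/-- Restriction to the hyperplane `ℓ = 0`, realized as an endomorphism of `R` that eliminates one
variable, so that the restricted forms remain linear forms in the same polynomial ring. -/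
theorem exists_specialization {l : MvPolynomial (Fin k) K} (hl : l.IsHomogeneous 1)
    (hl0 : l ≠ 0) :
    ∃ φ : MvPolynomial (Fin k) K →ₐ[K] MvPolynomial (Fin k) K,
      φ l = 0 ∧ (∀ p, l ∣ p - φ p) ∧
      ∀ v : MvPolynomial (Fin k) K, v.IsHomogeneous 1 → ∃ c : K, φ v = v - c • l := by
  obtain ⟨d, hd⟩ := MvPolynomial.ne_zero_iff.1 hl0
  obtain ⟨i, rfl⟩ : ∃ i, d = Finsupp.single i 1 := by
    have h1 : d.degree = 1 := by
      by_contra h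
      exact hd (hl.coeff_eq_zero h)
    exact (Finsupp.sum_eq_one_iff d).1 h1
  -- `φ` replaces `xᵢ`, a variable which occurs in `ℓ`, by `xᵢ - a⁻¹ ℓ`
  set a := coeff (Finsupp.single i 1) l with ha
  let φ : MvPolynomial (Fin k) K →ₐ[K] MvPolynomial (Fin k) K :=
    aeval fun j => X j - (coeff (Finsupp.single i 1) (X j : MvPolynomial (Fin k) K) * a⁻¹) • l
  have hφ : ∀ v : MvPolynomial (Fin k) K, v.IsHomogeneous 1 →
      φ v = v - (coeff (Finsupp.single i 1) v * a⁻¹) • l := by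
    intro v hv
    have hv' : v ∈ Submodule.span K (Set.range (X : Fin k → MvPolynomial (Fin k) K)) := by
      rw [← homogeneousSubmodule_one_eq_span_X]
      exact (mem_homogeneousSubmodule _ _).2 hv
    induction hv' using Submodule.span_induction with
    | mem x h => obtain ⟨j, rfl⟩ := h; simp [φ]
    | zero => simp
    | add x y hx hy h1 h2 =>
      have e : ∀ z ∈ Submodule.span K (Set.range (X : Fin k → MvPolynomial (Fin k) K)),
          z.IsHomogeneous 1 := fun z hz => by
        rw [← homogeneousSubmodule_one_eq_span_X] at hz
        exact (mem_homogeneousSubmodule _ _).1 hz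
      rw [map_add, h1 (e x hx), h2 (e y hy), coeff_add, add_mul, add_smul]
      abel
    | smul c x hx h =>
      have e : x.IsHomogeneous 1 := by
        rw [← homogeneousSubmodule_one_eq_span_X] at hx
        exact (mem_homogeneousSubmodule _ _).1 hx
      rw [map_smul, h e, coeff_smul, smul_sub, smul_smul, smul_eq_mul, mul_assoc]
  refine ⟨φ, ?_, ?_, fun v hv => ⟨_, hφ v hv⟩⟩
  · rw [hφ l hl, mul_inv_cancel₀ hd, one_smul, sub_self]
  · intro p
    induction p using MvPolynomial.induction_on with
    | C r => simp [φ]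
    | add p q hp hq =>
      rw [map_add, add_sub_add_comm]
      exact dvd_add hp hq
    | mul_X p j hp =>
      have : p * X j - φ (p * X j) = (p - φ p) * X j + φ p * (X j - φ (X j)) := by
        rw [map_mul]; ring
      rw [this]
      refine dvd_add (hp.mul_right _) (Dvd.dvd.mul_left ?_ _)
      rw [hφ _ (isHomogeneous_X _ _), sub_sub_cancel, smul_eq_C_mul]
      exact dvd_mul_left _ _

/-! ### The map onto the Rees algebra -/

/-- The `R`-algebra map `R[y₁, …, yₙ] → R[t]`, `yᵢ ↦ (∏_{j ≠ i} ℓⱼ) t`. Its kernel is the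
presentation ideal of the Rees algebra of the `(n-1)`-fold products, with the forms `ℓᵢ` allowed to
be proportional. -/
noncomputable def productHom {R : Type*} [CommRing R] {n : ℕ} (l : Fin n → R) :
    MvPolynomial (Fin n) R →ₐ[R] Polynomial R :=
  aeval fun i => Polynomial.C (∏ j ∈ Finset.univ.erase i, l j) * Polynomial.X

theorem prod_erase_succ {R : Type*} [CommRing R] {n : ℕ} (l : Fin (n + 1) → R) (i : Fin n) :
    ∏ j ∈ Finset.univ.erase i.succ, l j = l 0 * ∏ j ∈ Finset.univ.erase i, l j.succ := by
  have : (Finset.univ : Finset (Fin (n + 1))).erase i.succ =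
      insert 0 ((Finset.univ.erase i).map (Fin.succEmb n)) := by
    ext j
    refine Fin.cases ?_ (fun j => ?_) j <;> simp [Fin.succ_ne_zero, eq_comm]
  rw [this, Finset.prod_insert (by simp [Fin.succ_ne_zero]), Finset.prod_map]
  rfl

theorem prod_erase_zero {R : Type*} [CommRing R] {n : ℕ} (l : Fin (n + 1) → R) :
    ∏ j ∈ Finset.univ.erase 0, l j = ∏ j, l (Fin.succ j) := by
  have : (Finset.univ : Finset (Fin (n + 1))).erase 0 = Finset.univ.map (Fin.succEmb n) := by
    ext j
    refine Fin.cases ?_ (fun j => ?_) j <;> simp [Fin.succ_ne_zero]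
  rw [this, Finset.prod_map]
  rfl

theorem productHom_X_zero {R : Type*} [CommRing R] (l : Fin (n + 1) → R) :
    productHom l (X 0) = Polynomial.C (∏ j, l (Fin.succ j)) * Polynomial.X := by
  rw [productHom, aeval_X, prod_erase_zero]

theorem productHom_rename_succ {R : Type*} [CommRing R] (l : Fin (n + 1) → R)
    (G : MvPolynomial (Fin n) R) :
    productHom l (rename Fin.succ G) =
      (productHom (fun i => l i.succ) G).comp (Polynomial.C (l 0) * Polynomial.X) := by
  have : (productHom l).comp (rename Fin.succ) =
      (Polynomial.aeval (Polynomial.C (l 0) * Polynomial.X)).comp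
        (productHom fun i => l i.succ) := by
    refine MvPolynomial.algHom_ext fun i => ?_
    simp [productHom, prod_erase_succ]
    ring
  simpa [Polynomial.aeval_def, Polynomial.comp] using DFunLike.congr_fun this G

theorem productHom_map {R : Type*} [CommRing R] (φ : R →+* R) (l : Fin n → R)
    (G : MvPolynomial (Fin n) R) :
    productHom (fun i => φ (l i)) (map φ G) = (productHom l G).map φ := by
  induction G using MvPolynomial.induction_on with
  | C r => simp [productHom, Polynomial.algebraMap_eq]
  | add p q hp hq => simp [hp, hq]
  | mul_X p j hp =>
    rw [map_mul, map_mul, hp, map_mul, Polynomial.map_mul]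
    simp [productHom, map_prod, Polynomial.map_prod]

theorem comp_C_mul_X_injective {R : Type*} [CommRing R] [IsDomain R] {a : R} (ha : a ≠ 0)
    {p : Polynomial R} (h : p.comp (Polynomial.C a * Polynomial.X) = 0) : p = 0 :=
  (Polynomial.comp_C_mul_X_eq_zero_iff (mem_nonZeroDivisors_of_ne_zero ha)).1 h

/-- Divide `yᵢ ↦ fᵢ t` by `ℓ₀`, so that `y₀` acquires a pole along `ℓ₀ = 0` while the other `yᵢ`
stay regular. The leading coefficient in `y₀` of an element of the kernel gives its polar part, which has
to vanish on that hyperplane. -/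
theorem productHom_map_leadingCoeff {R : Type*} [CommRing R] [IsDomain R]
    {l : Fin (n + 1) → R} (hl : l 0 ≠ 0) (φ : R →+* R) (hφ0 : φ (l 0) = 0)
    (hφ : ∀ i : Fin n, φ (l i.succ) ≠ 0) (m : ℕ) (p : ℕ → MvPolynomial (Fin n) R)
    (h : productHom l (∑ j ∈ Finset.range (m + 1), rename Fin.succ (p j) * X 0 ^ j) = 0) :
    productHom (fun i : Fin n => φ (l i.succ)) (map φ (p m)) = 0 := by
  set g := ∏ j, l (Fin.succ j) with hg
  -- `∑ pⱼ y₀ʲ` evaluated at `t / ℓ₀` and multiplied by `ℓ₀ᵐ`; substituting `ℓ₀ t` for `t` turns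
  -- it into `ℓ₀ᵐ` times the image of `∑ pⱼ y₀ʲ`
  have key : ∑ j ∈ Finset.range (m + 1), productHom (fun i => l i.succ) (p j) *
      (Polynomial.C (l 0 ^ (m - j)) * (Polynomial.C g * Polynomial.X) ^ j) = 0 := by
    refine comp_C_mul_X_injective hl ?_
    have h2 := congrArg (fun q => Polynomial.C (l 0 ^ m) * q) h
    simp only [mul_zero, map_sum, Finset.mul_sum, map_mul, map_pow, productHom_rename_succ,
      productHom_X_zero] at h2
    rw [← h2, Polynomial.sum_comp]
    refine Finset.sum_congr rfl fun j hj => ?_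
    obtain ⟨e, rfl⟩ := Nat.exists_eq_add_of_le (Nat.lt_succ_iff.1 (Finset.mem_range.1 hj))
    simp only [Polynomial.mul_comp, Polynomial.pow_comp, Polynomial.C_comp, Polynomial.X_comp,
      Nat.add_sub_cancel_left, map_pow, hg]
    ring
  -- restricted to `ℓ₀ = 0`, only the term of index `m` survives
  have h3 := congrArg (Polynomial.map φ) key
  rw [Polynomial.map_sum, Finset.sum_range_succ, Finset.sum_eq_zero, zero_add] at h3
  · rw [productHom_map φ (fun i => l i.succ)]
    simp only [Polynomial.map_mul, Polynomial.map_pow, Polynomial.map_C, Polynomial.map_X,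
      Polynomial.map_zero, Nat.sub_self, pow_zero, map_one, one_mul] at h3
    refine (mul_eq_zero.1 h3).resolve_right (pow_ne_zero _ (mul_ne_zero ?_ Polynomial.X_ne_zero))
    rw [Ne, Polynomial.C_eq_zero, hg, map_prod]
    exact Finset.prod_ne_zero_iff.2 fun i _ => hφ i
  · intro j hj
    have : m - j ≠ 0 := by have := Finset.mem_range.1 hj; omega
    simp [hφ0, this]

/-! ### The ideal of relations -/

/-- The ideal of `T` generated by the `ℓᵢ yᵢ - ℓⱼ yⱼ` and by the Orlik–Terao relations `∂D` of a
family of linear forms, which may be proportional to each other. -/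
noncomputable def relationIdeal (l : Fin n → MvPolynomial (Fin k) K) :
    Ideal (MvPolynomial (Fin n) (MvPolynomial (Fin k) K)) :=
  Ideal.span ({F | ∃ i j, F = C (l i) * X i - C (l j) * X j} ∪
    {F | ∃ (s : Finset (Fin n)) (c : Fin n → K), ∑ i ∈ s, c i • l i = 0 ∧
      F = inclST K k n (CentralArrangement.boundary s c)})

theorem sub_mem_relationIdeal (l : Fin n → MvPolynomial (Fin k) K) (i j : Fin n) :
    C (l i) * X i - C (l j) * X j ∈ relationIdeal l :=
  Ideal.subset_span (Or.inl ⟨i, j, rfl⟩)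

theorem boundary_mem_relationIdeal (l : Fin n → MvPolynomial (Fin k) K) {s : Finset (Fin n)}
    {c : Fin n → K} (h : ∑ i ∈ s, c i • l i = 0) :
    inclST K k n (CentralArrangement.boundary s c) ∈ relationIdeal l :=
  Ideal.subset_span (Or.inr ⟨s, c, h, rfl⟩)

theorem rename_succ_boundary (s : Finset (Fin n)) (c : Fin (n + 1) → K) :
    rename Fin.succ (CentralArrangement.boundary s fun i => c i.succ) =
      CentralArrangement.boundary (s.map (Fin.succEmb n)) c := by
  simp only [CentralArrangement.boundary, map_sum, map_mul, map_prod, Finset.sum_map, rename_C]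
  refine Finset.sum_congr rfl fun i _ => ?_
  rw [← Finset.map_erase, Finset.prod_map]
  simp

theorem boundary_insert_zero (s : Finset (Fin n)) (c : Fin (n + 1) → K) :
    CentralArrangement.boundary (insert 0 (s.map (Fin.succEmb n))) c =
      C (c 0) * rename Fin.succ (∏ i ∈ s, X i) +
        X 0 * rename Fin.succ (CentralArrangement.boundary s fun i => c i.succ) := by
  have h0 : (0 : Fin (n + 1)) ∉ s.map (Fin.succEmb n) := by simp [Fin.succ_ne_zero]
  rw [rename_succ_boundary, CentralArrangement.boundary, Finset.sum_insert h0,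
    Finset.erase_insert h0, Finset.prod_map, map_prod, CentralArrangement.boundary, Finset.mul_sum]
  congr 1
  · simp
  · refine Finset.sum_congr rfl fun i hi => ?_
    have hi0 : i ≠ 0 := fun h => h0 (h ▸ hi)
    rw [Finset.erase_insert_of_ne hi0.symm,
      Finset.prod_insert (fun h => h0 (Finset.mem_of_mem_erase h))]
    ring

theorem inclST_rename (p : MvPolynomial (Fin n) K) :
    inclST K k (n + 1) (rename Fin.succ p) = rename Fin.succ (inclST K k n p) :=
  MvPolynomial.map_rename _ _ _

theorem map_rename_relationIdeal_le (l : Fin (n + 1) → MvPolynomial (Fin k) K) :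
    relationIdeal (fun i : Fin n => l i.succ) ≤
      (relationIdeal l).comap (rename Fin.succ : _ →ₐ[MvPolynomial (Fin k) K] _) := by
  rw [relationIdeal, Ideal.span_le]
  rintro F (⟨i, j, rfl⟩ | ⟨s, c, h, rfl⟩)
  · simpa using sub_mem_relationIdeal l i.succ j.succ
  · have := rename_succ_boundary s (Fin.cons 0 c : Fin (n + 1) → K)
    simp only [Fin.cons_succ] at this
    rw [SetLike.mem_coe, Ideal.mem_comap, ← inclST_rename, this]
    exact boundary_mem_relationIdeal l (by simpa using h)

/-! ### Elimination of a variable -/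

/-- The ideal of those `G ∈ T'` for which `y₀ G` is congruent to an element of `T'` modulo the
relations, where `T'` is the polynomial ring in the variables other than `y₀`. -/
noncomputable def eliminationIdeal (l : Fin (n + 1) → MvPolynomial (Fin k) K) :
    Ideal (MvPolynomial (Fin n) (MvPolynomial (Fin k) K)) where
  carrier := {G | ∃ G', X 0 * rename Fin.succ G - rename Fin.succ G' ∈ relationIdeal l}
  zero_mem' := ⟨0, by simp⟩
  add_mem' := by
    rintro a b ⟨a', ha⟩ ⟨b', hb⟩
    refine ⟨a' + b', ?_⟩
    rw [map_add, map_add, mul_add, add_sub_add_comm]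
    exact add_mem ha hb
  smul_mem' := by
    rintro c a ⟨a', ha⟩
    refine ⟨c * a', ?_⟩
    rw [smul_eq_mul, map_mul, map_mul, mul_left_comm, ← mul_sub]
    exact Ideal.mul_mem_left _ _ ha

theorem mem_eliminationIdeal {l : Fin (n + 1) → MvPolynomial (Fin k) K}
    {G : MvPolynomial (Fin n) (MvPolynomial (Fin k) K)} :
    G ∈ eliminationIdeal l ↔
      ∃ G', X 0 * rename Fin.succ G - rename Fin.succ G' ∈ relationIdeal l :=
  Iff.rfl

theorem C_form_zero_mem_eliminationIdeal (l : Fin (n + 2) → MvPolynomial (Fin k) K) :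
    C (l 0) ∈ eliminationIdeal l := by
  refine mem_eliminationIdeal.2 ⟨C (l (Fin.succ 0)) * X 0, ?_⟩
  have := sub_mem_relationIdeal l 0 (Fin.succ 0)
  rwa [map_mul, rename_C, rename_C, rename_X, mul_comm (X 0)]

theorem relationIdeal_le_eliminationIdeal (l : Fin (n + 1) → MvPolynomial (Fin k) K) :
    relationIdeal (fun i : Fin n => l i.succ) ≤ eliminationIdeal l := fun G h => by
  refine mem_eliminationIdeal.2 ⟨0, ?_⟩
  rw [map_zero, sub_zero]
  exact Ideal.mul_mem_left _ (X 0) (map_rename_relationIdeal_le l h)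

/-- A dependency `∑ cᵢ ℓᵢ = d ℓ₀` has boundary `y₀ ∂D - d ∏ yᵢ`, where `∂D` is formed as if
`∑ cᵢ ℓᵢ` were zero. -/
theorem boundary_mem_eliminationIdeal (l : Fin (n + 1) → MvPolynomial (Fin k) K)
    {s : Finset (Fin n)} {c : Fin n → K} {d : K} (h : ∑ i ∈ s, c i • l i.succ = d • l 0) :
    inclST K k n (CentralArrangement.boundary s c) ∈ eliminationIdeal l := by
  have hb := boundary_mem_relationIdeal l (s := insert 0 (s.map (Fin.succEmb n)))
    (c := Fin.cons (-d) c) (by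
      rw [Finset.sum_insert (by simp [Fin.succ_ne_zero]), Finset.sum_map]
      simp [h])
  refine mem_eliminationIdeal.2 ⟨inclST K k n (C d * ∏ i ∈ s, X i), ?_⟩
  rw [boundary_insert_zero] at hb
  simp only [Fin.cons_succ, Fin.cons_zero] at hb
  have e : inclST K k (n + 1) (X 0) = X 0 := MvPolynomial.map_X _ _
  have e1 : ∀ m, inclST K k m (C d) = C (C d) := fun m => MvPolynomial.map_C _ _
  have e2 : inclST K k (n + 1) (C (-d)) = -C (C d) := by
    rw [← C_neg, ← C_neg]
    exact MvPolynomial.map_C _ _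
  rw [map_add, map_mul, map_mul, e, e2, inclST_rename, inclST_rename] at hb
  rw [map_mul, map_mul, e1, rename_C]
  have e3 : ∀ a b c : MvPolynomial (Fin (n + 1)) (MvPolynomial (Fin k) K),
      a - b * c = -b * c + a := fun a b c => by ring
  rw [e3]
  exact hb

/-- If `G` specializes to a relation among the restricted forms `φ(ℓ₁), …, φ(ℓₙ)`, then `y₀ G` can
be rewritten without `y₀`: the elements `φ(ℓᵢ) yᵢ - φ(ℓⱼ) yⱼ` and the boundaries of dependencies
among the restrictions all lift, up to multiples of `ℓ₀`, and `y₀ ℓ₀ ≡ y₁ ℓ₁`. At least two forms are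
needed for this last congruence. -/
theorem mem_eliminationIdeal_of_specialization {l : Fin (n + 2) → MvPolynomial (Fin k) K}
    (hl : ∀ i, (l i).IsHomogeneous 1)
    {φ : MvPolynomial (Fin k) K →ₐ[K] MvPolynomial (Fin k) K}
    (hφ1 : ∀ p, l 0 ∣ p - φ p)
    (hφ2 : ∀ v : MvPolynomial (Fin k) K, v.IsHomogeneous 1 → ∃ c : K, φ v = v - c • l 0)
    {G : MvPolynomial (Fin (n + 1)) (MvPolynomial (Fin k) K)}
    (hG : map (φ : MvPolynomial (Fin k) K →+* MvPolynomial (Fin k) K) G ∈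
      relationIdeal fun i : Fin (n + 1) => φ (l i.succ)) :
    G ∈ eliminationIdeal l := by
  have hsub : ∀ p, C (p - φ p) ∈ eliminationIdeal l := fun p => by
    obtain ⟨q, hq⟩ := hφ1 p
    rw [hq, map_mul]
    exact Ideal.mul_mem_right _ _ (C_form_zero_mem_eliminationIdeal l)
  have hmap : ∀ G, G - map (φ : MvPolynomial (Fin k) K →+* MvPolynomial (Fin k) K) G ∈
      eliminationIdeal l := fun G => by
    induction G using MvPolynomial.induction_on with
    | C r =>
      rw [map_C, ← map_sub]
      exact hsub r
    | add p q hp hq =>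
      rw [map_add, add_sub_add_comm]
      exact add_mem hp hq
    | mul_X p j hp =>
      rw [map_mul, map_X, ← sub_mul]
      exact Ideal.mul_mem_right _ _ hp
  suffices h : (relationIdeal fun i : Fin (n + 1) => φ (l i.succ)) ≤ eliminationIdeal l by
    have := add_mem (hmap G) (h hG)
    rwa [sub_add_cancel] at this
  rw [relationIdeal, Ideal.span_le]
  rintro F (⟨i, j, rfl⟩ | ⟨s, c, h, rfl⟩)
  · have e : C (φ (l i.succ)) * X i - C (φ (l j.succ)) * X j =
        (C (l i.succ) * X i - C (l j.succ) * X j) - C (l i.succ - φ (l i.succ)) * X i +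
          C (l j.succ - φ (l j.succ)) * X j := by
      rw [C_sub, C_sub]
      ring
    rw [e]
    exact add_mem (sub_mem (relationIdeal_le_eliminationIdeal l (sub_mem_relationIdeal _ i j))
      (Ideal.mul_mem_right _ _ (hsub _))) (Ideal.mul_mem_right _ _ (hsub _))
  · obtain ⟨d, hd⟩ := hφ2 (∑ i ∈ s, c i • l i.succ)
      (IsHomogeneous.sum _ _ _ fun i _ => by
        rw [smul_eq_C_mul]; exact (hl _).C_mul _)
    refine boundary_mem_eliminationIdeal l (d := d) ?_
    rw [map_sum] at hd
    simp only [map_smul] at hd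
    rw [h] at hd
    exact sub_eq_zero.1 hd.symm

/-! ### The kernel of the map onto the Rees algebra -/

theorem eq_zero_of_productHom_eq_zero {R : Type*} [CommRing R] {l : Fin 1 → R}
    {F : MvPolynomial (Fin 1) R} (h : productHom l F = 0) : F = 0 := by
  have : (Polynomial.aeval (X 0)).comp (productHom l) = AlgHom.id R (MvPolynomial (Fin 1) R) := by
    refine MvPolynomial.algHom_ext fun i => ?_
    rw [Subsingleton.elim i 0]
    simp [productHom]
  have h2 := DFunLike.congr_fun this F
  simpa [h] using h2.symm

theorem finSuccEquiv_rename_succ {R : Type*} [CommRing R] (G : MvPolynomial (Fin n) R) :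
    finSuccEquiv R n (rename Fin.succ G) = Polynomial.C G := by
  induction G using MvPolynomial.induction_on with
  | C r => simp [finSuccEquiv_apply]
  | add p q hp hq => simp [hp, hq]
  | mul_X p j hp => simp [hp, finSuccEquiv_X_succ]

theorem exists_eq_sum_rename_succ_mul_X_zero_pow {R : Type*} [CommRing R]
    (F : MvPolynomial (Fin (n + 1)) R) :
    ∃ (m : ℕ) (p : ℕ → MvPolynomial (Fin n) R),
      F = ∑ j ∈ Finset.range (m + 1), rename Fin.succ (p j) * X 0 ^ j := by
  refine ⟨(finSuccEquiv R n F).natDegree, (finSuccEquiv R n F).coeff, ?_⟩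
  apply (finSuccEquiv R n).injective
  conv_lhs => rw [(finSuccEquiv R n F).as_sum_range_C_mul_X_pow]
  simp only [map_sum, map_mul, map_pow, finSuccEquiv_X_zero, finSuccEquiv_rename_succ]

theorem mem_relationIdeal_of_rename_succ {l : Fin (n + 1) → MvPolynomial (Fin k) K}
    (hl0 : l 0 ≠ 0)
    (ih : ∀ G, productHom (fun i : Fin n => l i.succ) G = 0 →
      G ∈ relationIdeal fun i : Fin n => l i.succ)
    {G : MvPolynomial (Fin n) (MvPolynomial (Fin k) K)}
    (h : productHom l (rename Fin.succ G) = 0) : rename Fin.succ G ∈ relationIdeal l := by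
  rw [productHom_rename_succ] at h
  exact map_rename_relationIdeal_le l (ih G (comp_C_mul_X_injective hl0 h))

theorem productHom_sub {R : Type*} [CommRing R] (l : Fin n → R) (i j : Fin n) :
    productHom l (C (l i) * X i - C (l j) * X j) = 0 := by
  simp only [map_sub, map_mul, productHom, aeval_X, algHom_C, Polynomial.algebraMap_eq]
  rw [← mul_assoc, ← mul_assoc, ← map_mul, ← map_mul, Finset.mul_prod_erase _ _ (Finset.mem_univ _),
    Finset.mul_prod_erase _ _ (Finset.mem_univ _), sub_self]

theorem productHom_boundary {l : Fin n → MvPolynomial (Fin k) K} (hl : ∀ i, l i ≠ 0)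
    {s : Finset (Fin n)} {c : Fin n → K} (h : ∑ i ∈ s, c i • l i = 0) :
    productHom l (inclST K k n (CentralArrangement.boundary s c)) = 0 := by
  have e : ∀ i, Polynomial.C (l i) * productHom l (X i) =
      Polynomial.C (∏ j, l j) * Polynomial.X := fun i => by
    rw [productHom, aeval_X, ← mul_assoc, ← map_mul, Finset.mul_prod_erase _ _ (Finset.mem_univ _)]
  -- multiplied by `∏_{j ∈ s} ℓⱼ`, every summand becomes `cᵢ ℓᵢ` times the same power of `f t`
  have hP : Polynomial.C (∏ j ∈ s, l j) ≠ 0 := by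
    rw [Ne, Polynomial.C_eq_zero]
    exact Finset.prod_ne_zero_iff.2 fun i _ => hl i
  refine (mul_eq_zero.1 ?_).resolve_left hP
  calc Polynomial.C (∏ j ∈ s, l j) *
        productHom l (inclST K k n (CentralArrangement.boundary s c))
      = ∑ i ∈ s, Polynomial.C (c i • l i) *
          (Polynomial.C (∏ j, l j) * Polynomial.X) ^ (s.card - 1) := by
        simp only [CentralArrangement.boundary, map_sum, Finset.mul_sum]
        refine Finset.sum_congr rfl fun i hi => ?_
        rw [← Finset.card_erase_of_mem hi, ← Finset.prod_const]
        rw [← Finset.prod_congr rfl fun j _ => e j, Finset.prod_mul_distrib,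
          ← Finset.mul_prod_erase s l hi, smul_eq_C_mul]
        simp only [inclST, map_mul, map_prod, map_C, map_X, algHom_C, Polynomial.algebraMap_eq]
        ring
    _ = 0 := by rw [← Finset.sum_mul, ← map_sum, h, map_zero, zero_mul]

theorem relationIdeal_le_ker {l : Fin n → MvPolynomial (Fin k) K} (hl : ∀ i, l i ≠ 0) :
    relationIdeal l ≤ RingHom.ker (productHom l) := by
  rw [relationIdeal, Ideal.span_le]
  rintro F (⟨i, j, rfl⟩ | ⟨s, c, h, rfl⟩)
  · exact productHom_sub l i j
  · exact productHom_boundary hl h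

/-- If `ℓ_b = c ℓ₀`, the boundary of this dependency is `y₀ - c y_b`, so `y₀` is redundant. -/
theorem exists_sub_rename_succ_mem {l : Fin (n + 1) → MvPolynomial (Fin k) K} {b : Fin n} {c : K}
    (hb : l b.succ = c • l 0)
    (F : MvPolynomial (Fin (n + 1)) (MvPolynomial (Fin k) K)) :
    ∃ G, F - rename Fin.succ G ∈ relationIdeal l := by
  have hX : X 0 - rename Fin.succ (C (C c) * X b) ∈ relationIdeal l := by
    have h0 : (0 : Fin (n + 1)) ∉ ({b} : Finset (Fin n)).map (Fin.succEmb n) := by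
      simpa using (Fin.succ_ne_zero b).symm
    have := boundary_mem_relationIdeal l
      (s := insert 0 (({b} : Finset (Fin n)).map (Fin.succEmb n)))
      (c := Fin.cons (-c) fun _ => 1) (by
        rw [Finset.sum_insert h0]
        simp [hb])
    rw [boundary_insert_zero] at this
    convert this using 1
    simp [CentralArrangement.boundary, inclST]
    ring
  induction F using MvPolynomial.induction_on with
  | C r => exact ⟨C r, by simp⟩
  | add p q hp hq =>
    obtain ⟨p', hp⟩ := hp
    obtain ⟨q', hq⟩ := hq
    refine ⟨p' + q', ?_⟩
    rw [map_add, add_sub_add_comm]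
    exact add_mem hp hq
  | mul_X p j hp =>
    obtain ⟨p', hp⟩ := hp
    have hj : ∃ q, X j - rename Fin.succ q ∈ relationIdeal l := by
      refine Fin.cases ⟨_, hX⟩ (fun j => ⟨X j, by simp⟩) j
    obtain ⟨q, hq⟩ := hj
    refine ⟨p' * q, ?_⟩
    have e : p * X j - rename Fin.succ (p' * q) =
        (p - rename Fin.succ p') * X j + rename Fin.succ p' * (X j - rename Fin.succ q) := by
      rw [map_mul]; ring
    rw [e]
    exact add_mem (Ideal.mul_mem_right _ _ hp) (Ideal.mul_mem_left _ _ hq)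

/-- Every relation among the products `fᵢ t` is a consequence of the `ℓᵢ yᵢ - ℓⱼ yⱼ` and the `∂D`.
The induction on the number of forms passes to the restriction to `ℓ₀ = 0`, where distinct forms may
become proportional; hence no hypothesis of non-proportionality. -/
theorem ker_productHom_le : ∀ (n : ℕ) (l : Fin n → MvPolynomial (Fin k) K),
    (∀ i, (l i).IsHomogeneous 1) → (∀ i, l i ≠ 0) →
    ∀ F, productHom l F = 0 → F ∈ relationIdeal l := by
  intro n
  induction n with
  | zero =>
    intro l _ _ F hF
    obtain ⟨r, rfl⟩ := C_surjective (Fin 0) F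
    rw [algHom_C, Polynomial.algebraMap_eq, Polynomial.C_eq_zero] at hF
    simp [hF]
  | succ n ih =>
    intro l hl hl0 F hF
    have ih' := ih (fun i => l i.succ) (fun i => hl _) fun i => hl0 _
    obtain ⟨φ, hφ0, hφ1, hφ2⟩ := exists_specialization (hl 0) (hl0 0)
    by_cases hprop : ∃ b : Fin n, φ (l b.succ) = 0
    · -- `ℓ₀` is proportional to another form, so `y₀` is redundant
      obtain ⟨b, hb⟩ := hprop
      obtain ⟨c, hc⟩ := hφ2 _ (hl b.succ)
      rw [hb] at hc
      have hbc : l b.succ = c • l 0 := sub_eq_zero.1 hc.symm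
      obtain ⟨G, hG⟩ := exists_sub_rename_succ_mem hbc F
      have h1 : productHom l (F - rename Fin.succ G) = 0 := relationIdeal_le_ker hl0 hG
      rw [map_sub, hF, zero_sub, neg_eq_zero] at h1
      have := add_mem hG (mem_relationIdeal_of_rename_succ (hl0 0) ih' h1)
      rwa [sub_add_cancel] at this
    push Not at hprop
    cases n with
    | zero => rw [eq_zero_of_productHom_eq_zero hF]; exact zero_mem _
    | succ n =>
    obtain ⟨m, p, rfl⟩ := exists_eq_sum_rename_succ_mul_X_zero_pow F
    induction m generalizing p with
    | zero =>
      simp only [zero_add, Finset.range_one, Finset.sum_singleton, pow_zero, mul_one] at hF ⊢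
      exact mem_relationIdeal_of_rename_succ (hl0 0) ih' hF
    | succ m ihm =>
      have hlead := productHom_map_leadingCoeff (hl0 0)
        (φ : MvPolynomial (Fin k) K →+* MvPolynomial (Fin k) K) hφ0 hprop (m + 1) p hF
      have hhom : ∀ i : Fin (n + 1), (φ (l i.succ)).IsHomogeneous 1 := fun i => by
        obtain ⟨c, hc⟩ := hφ2 _ (hl i.succ)
        rw [hc, smul_eq_C_mul]
        exact (hl _).sub ((hl _).C_mul _)
      obtain ⟨G, hG⟩ := mem_eliminationIdeal.1 (mem_eliminationIdeal_of_specialization hl hφ1 hφ2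
        (ih (fun i => φ (l i.succ)) hhom hprop _ hlead))
      -- replacing `y₀ p_{m+1}` by `G` lowers the degree in `y₀`
      let q : ℕ → MvPolynomial (Fin (n + 1)) (MvPolynomial (Fin k) K) :=
        fun j => if j = m then p m + G else p j
      have hq : ∑ j ∈ Finset.range (m + 1), rename Fin.succ (q j) * X 0 ^ j =
          ∑ j ∈ Finset.range (m + 1 + 1), rename Fin.succ (p j) * X 0 ^ j -
            X 0 ^ m * (X 0 * rename Fin.succ (p (m + 1)) - rename Fin.succ G) := by
        rw [Finset.sum_range_succ, Finset.sum_range_succ _ (m + 1), Finset.sum_range_succ _ m,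
          Finset.sum_congr rfl (g := fun j => rename Fin.succ (p j) * X 0 ^ j) fun j hj => by
            simp only [q, if_neg (Finset.mem_range.1 hj).ne]]
        simp only [q, if_true, map_add]
        ring
      have hmem := Ideal.mul_mem_left _ (X 0 ^ m) hG
      have := ihm q (by
        rw [hq, map_sub, hF, zero_sub, neg_eq_zero]
        exact relationIdeal_le_ker hl0 hmem)
      rw [hq] at this
      have := add_mem this hmem
      rwa [sub_add_cancel] at this

theorem ker_productHom_eq {l : Fin n → MvPolynomial (Fin k) K}
    (hl : ∀ i, (l i).IsHomogeneous 1) (hl0 : ∀ i, l i ≠ 0) :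
    RingHom.ker (productHom l) = relationIdeal l :=
  le_antisymm (ker_productHom_le n l hl hl0) (relationIdeal_le_ker hl0)

/-! ### The presentation ideals of an arrangement -/

theorem reesIdeal_eq_ker_productHom {R : Type*} [CommRing R] (l : Fin n → R) :
    reesIdeal (fun i => ∏ j ∈ Finset.univ.erase i, l j) = RingHom.ker (productHom l) := by
  have : (reesAlgebra _).val.comp (reesPresentation fun i => ∏ j ∈ Finset.univ.erase i, l j) =
      productHom l := by
    refine MvPolynomial.algHom_ext fun i => ?_
    simp only [reesPresentation, productHom, AlgHom.comp_apply, aeval_X, Subalgebra.coe_val]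
    rw [← Polynomial.C_mul_X_eq_monomial]
  ext F
  rw [reesIdeal, RingHom.mem_ker, RingHom.mem_ker, ← this]
  simp

theorem exists_eq_sum_C_mul_X {R : Type*} [CommRing R] {F : MvPolynomial (Fin n) R}
    (hF : F.IsHomogeneous 1) : ∃ r : Fin n → R, F = ∑ i, C (r i) * X i := by
  have h : F ∈ Submodule.span R (Set.range (X : Fin n → MvPolynomial (Fin n) R)) := by
    rw [← homogeneousSubmodule_one_eq_span_X]
    exact (mem_homogeneousSubmodule _ _).2 hF
  obtain ⟨r, hr⟩ := (Submodule.mem_span_range_iff_exists_fun R).1 h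
  exact ⟨r, by simp only [← hr, smul_eq_C_mul]⟩

namespace CentralArrangement

variable (A : CentralArrangement K k n)

theorem reesIdeal_products : reesIdeal A.products = relationIdeal A.form := by
  rw [← ker_productHom_eq A.isHomogeneous A.ne_zero, ← reesIdeal_eq_ker_productHom]
  rfl

theorem sub_mem_consecutiveIdeal (i j : Fin n) :
    C (A.form i) * X i - C (A.form j) * X j ∈ A.consecutiveIdeal := by
  have hle : ∀ (d : ℕ) (i j : Fin n), j.val = i.val + d →
      C (A.form i) * X i - C (A.form j) * X j ∈ A.consecutiveIdeal := by
    intro d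
    induction d with
    | zero =>
      intro i j h
      rw [Fin.ext (a := j) (b := i) h, sub_self]
      exact zero_mem _
    | succ d ih =>
      intro i j h
      let m : Fin n := ⟨i.val + d, by omega⟩
      rw [← sub_add_sub_cancel _ (C (A.form m) * X m)]
      exact add_mem (ih i m rfl) (Ideal.subset_span ⟨m, j, h, rfl⟩)
  rcases le_total i j with h | h
  · exact hle (j.val - i.val) i j (by have : i.val ≤ j.val := h; omega)
  · rw [← neg_sub]
    exact neg_mem (hle (i.val - j.val) j i (by have : j.val ≤ i.val := h; omega))

theorem relationIdeal_form :
    relationIdeal A.form = A.consecutiveIdeal ⊔ A.orlikTeraoIdeal.map (inclST K k n) := by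
  rw [relationIdeal, Ideal.span_union]
  congr 1
  · refine le_antisymm (Ideal.span_le.2 ?_) (Ideal.span_mono ?_)
    · rintro F ⟨i, j, rfl⟩
      exact A.sub_mem_consecutiveIdeal i j
    · rintro F ⟨i, j, -, rfl⟩
      exact ⟨i, j, rfl⟩
  · rw [orlikTeraoIdeal, Ideal.map_span]
    congr 1
    ext F
    constructor
    · rintro ⟨s, c, h, rfl⟩
      exact ⟨_, ⟨s, c, h, rfl⟩, rfl⟩
    · rintro ⟨_, ⟨s, c, h, rfl⟩, rfl⟩
      exact ⟨s, c, h, rfl⟩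

/-- The form `ℓᵢ` is prime and divides no `ℓⱼ` with `j ≠ i`; both facts are read off from the
restriction to `ℓᵢ = 0`, whose kernel is `⟨ℓᵢ⟩`. -/
theorem form_dvd_of_dvd_mul_products {i : Fin n} {p : MvPolynomial (Fin k) K}
    (h : A.form i ∣ p * A.products i) : A.form i ∣ p := by
  obtain ⟨φ, hφ0, hφ1, hφ2⟩ := exists_specialization (A.isHomogeneous i) (A.ne_zero i)
  have h0 : φ p * φ (A.products i) = 0 := by
    obtain ⟨q, hq⟩ := h
    rw [← map_mul, hq, map_mul, hφ0, zero_mul]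
  have hP : φ (A.products i) ≠ 0 := by
    rw [products, map_prod]
    refine Finset.prod_ne_zero_iff.2 fun j hj h => ?_
    obtain ⟨c, hc⟩ := hφ2 _ (A.isHomogeneous j)
    rw [h] at hc
    exact A.not_proportional j i (Finset.ne_of_mem_erase hj) c (sub_eq_zero.1 hc.symm)
  simpa [(mul_eq_zero.1 h0).resolve_right hP] using hφ1 p

theorem form_dvd_products {i j : Fin n} (h : i ≠ j) : A.form i ∣ A.products j :=
  Finset.dvd_prod_of_mem _ (Finset.mem_erase.2 ⟨h, Finset.mem_univ _⟩)

/-- The syzygies of the products `f₁, …, fₙ` are generated by the `ℓᵢ eᵢ - ℓⱼ eⱼ`: in a syzygy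
`∑ rᵢ fᵢ = 0` the form `ℓᵢ` divides `rᵢ`, and the quotients `qᵢ` satisfy `∑ qᵢ = 0`. -/
theorem sum_C_mul_X_mem_consecutiveIdeal {r : Fin n → MvPolynomial (Fin k) K}
    (h : ∑ i, r i * A.products i = 0) : ∑ i, C (r i) * X i ∈ A.consecutiveIdeal := by
  have hdvd : ∀ i, A.form i ∣ r i := fun i => by
    refine A.form_dvd_of_dvd_mul_products ?_
    rw [← Finset.add_sum_erase _ _ (Finset.mem_univ i)] at h
    rw [eq_neg_of_add_eq_zero_left h, dvd_neg]
    exact Finset.dvd_sum fun j hj =>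
      (A.form_dvd_products (Finset.ne_of_mem_erase hj).symm).mul_left _
  choose q hq using hdvd
  have hsum : ∑ i, q i = 0 := by
    have hP : ∏ j, A.form j ≠ 0 := Finset.prod_ne_zero_iff.2 fun i _ => A.ne_zero i
    refine (mul_eq_zero.1 ?_).resolve_right hP
    rw [Finset.sum_mul, ← h]
    refine Finset.sum_congr rfl fun i _ => ?_
    rw [hq i, products, ← Finset.mul_prod_erase _ _ (Finset.mem_univ i)]
    ring
  rcases isEmpty_or_nonempty (Fin n) with hn | ⟨⟨a⟩⟩
  · simp
  have e : ∑ i, C (r i) * X i =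
      ∑ i, C (q i) * (C (A.form i) * X i - C (A.form a) * X a) := by
    simp only [mul_sub, Finset.sum_sub_distrib]
    rw [← Finset.sum_mul, ← map_sum, hsum, map_zero, zero_mul, sub_zero]
    refine Finset.sum_congr rfl fun i _ => ?_
    rw [hq i, map_mul]
    ring
  rw [e]
  exact sum_mem fun i _ => Ideal.mul_mem_left _ _ (A.sub_mem_consecutiveIdeal i a)

theorem symIdeal_products : symIdeal A.products = A.consecutiveIdeal := by
  refine le_antisymm (Ideal.span_le.2 ?_) (Ideal.span_le.2 ?_)
  · rintro F ⟨hF, hF1⟩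
    obtain ⟨r, rfl⟩ := exists_eq_sum_C_mul_X hF1
    refine A.sum_C_mul_X_mem_consecutiveIdeal ?_
    have h : productHom A.form (∑ i, C (r i) * X i) = 0 := by
      rw [← RingHom.mem_ker, ← reesIdeal_eq_ker_productHom]
      exact hF
    simp only [map_sum, map_mul, productHom, aeval_X, algHom_C, Polynomial.algebraMap_eq] at h
    simp only [← mul_assoc, ← Finset.sum_mul, ← map_mul, ← map_sum] at h
    exact Polynomial.C_eq_zero.1 ((mul_eq_zero.1 h).resolve_right Polynomial.X_ne_zero)
  · rintro F ⟨i, j, -, rfl⟩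
    refine Ideal.subset_span ⟨?_, (isHomogeneous_C_mul_X _ _).sub (isHomogeneous_C_mul_X _ _)⟩
    rw [A.reesIdeal_products]
    exact sub_mem_relationIdeal _ i j

/-- Setting `x = 0` sends `T` onto `S`, is the identity on `S` and kills the `ℓᵢ yᵢ - ℓⱼ yⱼ`; hence
only the Orlik–Terao relations survive in `𝓘 ∩ S`. -/
theorem fiberIdeal_products : fiberIdeal A.products = A.orlikTeraoIdeal := by
  have h0 : ∀ p, map (constantCoeff : MvPolynomial (Fin k) K →+* K) (inclST K k n p) = p :=
    fun p => by
      rw [inclST, map_map, constantCoeff_comp_C, map_id]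
  rw [fiberIdeal, A.reesIdeal_products, A.relationIdeal_form]
  refine le_antisymm (fun p hp => ?_) ?_
  · have hle : A.consecutiveIdeal ⊔ A.orlikTeraoIdeal.map (inclST K k n) ≤
        A.orlikTeraoIdeal.comap (map (constantCoeff : MvPolynomial (Fin k) K →+* K)) := by
      refine sup_le (Ideal.span_le.2 ?_) (Ideal.map_le_iff_le_comap.2 fun q hq => ?_)
      · rintro F ⟨i, j, -, rfl⟩
        have hc : ∀ i, constantCoeff (A.form i) = 0 := fun i =>
          (A.isHomogeneous i).coeff_eq_zero (by simp)
        simp [hc]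
      · rw [Ideal.mem_comap, Ideal.mem_comap, h0]
        exact hq
    have := hle hp
    rwa [Ideal.mem_comap, h0] at this
  · exact Ideal.map_le_iff_le_comap.1 le_sup_right

end CentralArrangement

end Blowup

theorem mainTheorem2 {K : Type*} [Field K] (k n : ℕ) (hk : 2 ≤ k) (hkn : k ≤ n)
    (A : Blowup.CentralArrangement K k n) :
    Blowup.IsFiberType A.products ∧
    Blowup.symIdeal A.products = A.consecutiveIdeal ∧
    Blowup.fiberIdeal A.products = A.orlikTeraoIdeal ∧
    Blowup.reesIdeal A.products =
      A.consecutiveIdeal ⊔ A.orlikTeraoIdeal.map (Blowup.inclST K k n) := by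
  have h : Blowup.reesIdeal A.products =
      A.consecutiveIdeal ⊔ A.orlikTeraoIdeal.map (Blowup.inclST K k n) := by
    rw [A.reesIdeal_products, A.relationIdeal_form]
  refine ⟨?_, A.symIdeal_products, A.fiberIdeal_products, h⟩
  rw [Blowup.IsFiberType, A.symIdeal_products, A.fiberIdeal_products, h]
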